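/- Let $n\ge 1$ and let $\alpha,\beta>0$ be real. The TASEP of size $n$ with entry rate $\alpha$ and exit rate $\beta$ is the Markov process on the words $\tau=\tau_1\cdots\tau_n\in\{0,1\}^n$ (where $\tau_i=1$ means that location $i$ is occupied) with the transitions $$0\tau'\overset{\alpha}{\rightharpoonup}1\tau',\qquad \tau'1\overset{\beta}{\rightharpoonup}\tau'0,\qquad \tau'10\tau''\overset{1}{\rightharpoonup}\tau'01\tau'',$$ where $X\overset{p}{\rightharpoonup}Y$ means that $X$ goes to $Y$ with probability $p/(n+1)$; with the remaining probability the state does not change. Let $P$ be its transition matrix. (If $\alpha$ or $\beta$ is so large that a diagonal entry of $P$ is negative, only the linear condition $\pi P=\pi$ below is used; it is the stationarity condition of the continuous-time process with these rates.) For $\tau\in\{0,1\}^n$ with exactly $k$ letters $1$, let $\lambda(\tau)=(\lambda_1,\dots,\lambda_k)$, where $\lambda_i$ is the number of $0$'s that follow the $i$-th $1$ in $\tau$, and put $\lambda_i=0$ for $i>k$. Let $A^{\alpha,\beta}_{\lambda(\tau)}=(A_{ij})_{1\le i,j\le k}$ be the matrix with entries $$A_{ij}=\binom{\lambda_{j+1}}{j-i+1}+\frac1\beta\binom{\lambda_{j+1}}{j-i}+\sum_{p=1}^{\lambda_j-\lambda_{j+1}}\frac{1}{\alpha^{p}}\left(\binom{\lambda_{j+1}+p-1}{j-i}+\frac1\beta\binom{\lambda_{j+1}+p-1}{j-i-1}\right),$$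 where $\binom{m}{r}=0$ for $r<0$, and the determinant of the empty matrix is $1$. Let $$Z_n=(\alpha\beta)^n\sum_{p=1}^n\frac{p}{2n-p}\binom{2n-p}{n}\frac{\alpha^{-p-1}-\beta^{-p-1}}{\alpha^{-1}-\beta^{-1}},$$ where for $\alpha=\beta$ the last quotient is replaced by its limit $(p+1)\alpha^{-p}$. Then there is exactly one probability vector $\pi$ on $\{0,1\}^n$ with $\pi P=\pi$, and its value $\Pr(\tau)=\pi(\tau)$, the stationary probability of the state $\tau$, is $$\Pr(\tau)=\frac{\alpha^{k+\lambda_1}\beta^n}{Z_n}\,\det A^{\alpha,\beta}_{\lambda(\tau)}\qquad\text{for every }\tau\in\{0,1\}^n,$$ where $k$ is the number of $1$'s in $\tau$ and $\lambda=\lambda(\tau)$. -/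

import Mathlib

namespace TASEP

/-- A state of the TASEP of size `n`: a word `τ` in `{0,1}ⁿ`. The letter `1` (a particle) is `true`,
the letter `0` (an empty location) is `false`; location `i` of the lattice is the index `i - 1`. -/
abbrev State (n : ℕ) : Type := Fin n → Bool

/-- A particle enters at the first location: `0τ' ⇀ 1τ'`. -/
def Enters {n : ℕ} (σ τ : State n) : Prop :=
  ∃ i : Fin n, (i : ℕ) = 0 ∧ σ i = false ∧ τ = Function.update σ i true

/-- A particle exits from the last location: `τ'1 ⇀ τ'0`. -/
def Exits {n : ℕ} (σ τ : State n) : Prop :=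
  ∃ i : Fin n, (i : ℕ) + 1 = n ∧ σ i = true ∧ τ = Function.update σ i false

/-- A particle hops one step to the right: `τ'10τ'' ⇀ τ'01τ''`. -/
def Hops {n : ℕ} (σ τ : State n) : Prop :=
  ∃ i j : Fin n, (j : ℕ) = (i : ℕ) + 1 ∧ σ i = true ∧ σ j = false ∧
    τ = Function.update (Function.update σ i false) j true

open Classical in
/-- The rate of the move from `σ` to `τ`: `α` for an entry, `β` for an exit, `1` for a hop, and `0`
for pairs of states that are not joined by a move (at most one of the three moves leads from `σ` to
`τ`). -/
noncomputable def rate {n : ℕ} (α β : ℝ) (σ τ : State n) : ℝ :=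
  (if Enters σ τ then α else 0) + (if Exits σ τ then β else 0) + (if Hops σ τ then 1 else 0)

/-- The transition matrix of the TASEP of size `n`: a move of rate `p` happens with probability
`p / (n + 1)`, and with the remaining probability the state does not change. -/
noncomputable def transition (n : ℕ) (α β : ℝ) : Matrix (State n) (State n) ℝ :=
  Matrix.of fun σ τ =>
    if τ = σ then 1 - ∑ ρ ∈ Finset.univ.erase σ, rate α β σ ρ / ((n : ℝ) + 1)
    else rate α β σ τ / ((n : ℝ) + 1)

/-- `π` is a stationary distribution of the TASEP: a probability vector (nonnegative entries with
sum `1`) such that `π P = π` for the transition matrix `P`. -/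
def IsStationaryDistribution {n : ℕ} (α β : ℝ) (π : State n → ℝ) : Prop :=
  π ∈ stdSimplex ℝ (State n) ∧ Matrix.vecMul π (transition n α β) = π

/-- The number `k` of particles (letters `1`) in `τ`. -/
def numParticles {n : ℕ} (τ : State n) : ℕ :=
  (Finset.univ.filter fun s : Fin n => τ s = true).card

/-- The part `λ_i` (`i ≥ 1`) of the partition `λ(τ)`: the number of `0`s that follow the `i`'th `1`,
that is, the number of `0`s with at least `i` letters `1` somewhere before them. It is `0` if `τ` has
fewer than `i` letters `1`, so `λ_{k+1} = 0`, and `λ_1 = 0` when `k = 0`. -/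
def lam {n : ℕ} (τ : State n) (i : ℕ) : ℕ :=
  (Finset.univ.filter fun s : Fin n =>
    τ s = false ∧ i ≤ (Finset.univ.filter fun r : Fin n => r < s ∧ τ r = true).card).card

/-- The binomial coefficient `m` choose `r` for an integer `r`; it is `0` for `r < 0`. -/
def binom (m : ℕ) (r : ℤ) : ℕ :=
  if r < 0 then 0 else m.choose r.toNat

/-- The entry `A_{ij}`, `1 ≤ i, j ≤ k`, of the matrix of the sequence `l = (λ_1, λ_2, …)`. -/
noncomputable def entry (α β : ℝ) (l : ℕ → ℕ) (i j : ℕ) : ℝ :=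
  ((binom (l (j + 1)) ((j : ℤ) - i + 1) : ℝ) + 1 / β * (binom (l (j + 1)) ((j : ℤ) - i) : ℝ)) +
    ∑ p ∈ Finset.Icc 1 (l j - l (j + 1)),
      (1 / α) ^ p * ((binom (l (j + 1) + p - 1) ((j : ℤ) - i) : ℝ) +
        1 / β * (binom (l (j + 1) + p - 1) ((j : ℤ) - i - 1) : ℝ))

/-- The `k × k` matrix `A_λ` with `λ = λ(τ)`; rows and columns `1, …, k` are the indices
`0, …, k - 1` of `Fin k`. -/
noncomputable def matrixA {n : ℕ} (α β : ℝ) (τ : State n) :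
    Matrix (Fin (numParticles τ)) (Fin (numParticles τ)) ℝ :=
  Matrix.of fun i j => entry α β (lam τ) ((i : ℕ) + 1) ((j : ℕ) + 1)

/-- The quotient `(α^{-p-1} - β^{-p-1}) / (α^{-1} - β^{-1})`, which for `α = β` is read as its limit
`(p + 1) α^{-p}` as `β → α`. -/
noncomputable def quot (α β : ℝ) (p : ℕ) : ℝ :=
  if α = β then ((p : ℝ) + 1) * α ^ (-(p : ℤ))
  else (α ^ (-(p : ℤ) - 1) - β ^ (-(p : ℤ) - 1)) / (α⁻¹ - β⁻¹)

/-- The partition function `Z_n`. -/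
noncomputable def Z (n : ℕ) (α β : ℝ) : ℝ :=
  (α * β) ^ n * ∑ p ∈ Finset.Icc 1 n,
    (p : ℝ) / (2 * (n : ℝ) - p) * ((2 * n - p).choose n : ℝ) * quot α β p

end TASEP

/-! The proof realises the matrix ansatz on real power series. With `x = 1/α` and `y = 1/β`, the
operators `opD` and `opE` satisfy DE = D + E, the vector 1 satisfies D1 = y·1, and the constant-term
functional is multiplied by x when composed with E. The constant term of the word in D and E applied
to 1 is thus a positive weight, and the three relations make the net flows telescope
(`isBalanced_weight`).

Stationary vectors are multiples of this weight by a minimum principle on an irreducible chain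
(`eq_smul_of_isBalanced`). The total weight is the constant term of (D + E)^n 1, and normal ordering
expands it with ballot numbers (`opC_pow`).

For the determinant, det A is bordered by a column of coefficients of a series. Removing the last
row turns the border series into a new one, by the same recursion that describes D and E on the word
after the denominators (1 + X) are cleared (`det_hess_succ`, `vec_eq_detVec`). -/

namespace TASEP

open PowerSeries

/-! ### Matrix ansatz on power series -/

/-- The power series `(h - h₀) / X`. -/
noncomputable def shift : ℝ⟦X⟧ →ₗ[ℝ] ℝ⟦X⟧ where
  toFun h := PowerSeries.mk fun n => coeff (n + 1) h
  map_add' _ _ := by ext; simp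
  map_smul' _ _ := by ext; simp

lemma coeff_shift (h : ℝ⟦X⟧) (n : ℕ) : coeff n (shift h) = coeff (n + 1) h := by
  simp [shift]

lemma X_mul_shift (h : ℝ⟦X⟧) : X * shift h = h - C (constantCoeff h) :=
  (sub_const_eq_X_mul_shift h).symm

/-- The operator `D` of the matrix ansatz, acting on power series. -/
noncomputable def opD (y : ℝ) : ℝ⟦X⟧ →ₗ[ℝ] ℝ⟦X⟧ where
  toFun h := C (y * constantCoeff h) - shift h
  map_add' _ _ := by simp only [map_add, mul_add]; ring
  map_smul' r h := by
    simp only [map_smul, RingHom.id_apply, smul_sub, constantCoeff_smul]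
    ext n; simp [coeff_C, mul_left_comm]

/-- The operator `E` of the matrix ansatz, acting on power series. -/
noncomputable def opE (x y : ℝ) : ℝ⟦X⟧ →ₗ[ℝ] ℝ⟦X⟧ where
  toFun h := (1 + X)⁻¹ * (h + C ((x - 1) * constantCoeff h) * (1 + C y * X))
  map_add' _ _ := by simp only [map_add, map_mul]; ring
  map_smul' r h := by
    simp only [RingHom.id_apply, smul_eq_C_mul, map_mul, constantCoeff_C]; ring

lemma one_add_X_mul_opE (x y : ℝ) (h : ℝ⟦X⟧) :
    (1 + X) * opE x y h = h + C ((x - 1) * constantCoeff h) * (1 + C y * X) := by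
  change (1 + X) * ((1 + X)⁻¹ * (h + C ((x - 1) * constantCoeff h) * (1 + C y * X))) = _
  rw [← mul_assoc, PowerSeries.mul_inv_cancel _ (by simp), one_mul]

lemma X_mul_opD (y : ℝ) (h : ℝ⟦X⟧) :
    X * opD y h = C (constantCoeff h) * (1 + C y * X) - h := by
  change X * (C (y * constantCoeff h) - shift h) = _
  rw [mul_sub, X_mul_shift, map_mul]; ring

lemma constantCoeff_opE (x y : ℝ) (h : ℝ⟦X⟧) :
    constantCoeff (opE x y h) = x * constantCoeff h := by
  have := congrArg constantCoeff (one_add_X_mul_opE x y h)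
  simp at this
  linarith

/-- The relation DE = D + E. Multiplying by X(1 + X) clears the shift in D and the inverse in E,
leaving a polynomial identity. -/
lemma opD_opE (x y : ℝ) (h : ℝ⟦X⟧) : opD y (opE x y h) = opD y h + opE x y h := by
  have hX : (X : ℝ⟦X⟧) * (1 + X) ≠ 0 := mul_ne_zero X_ne_zero fun h0 => by
    have := congrArg constantCoeff h0
    simp at this
  refine mul_left_cancel₀ hX ?_
  have h1 := X_mul_opD y (opE x y h)
  have h2 := X_mul_opD y h
  have h3 := one_add_X_mul_opE x y h
  rw [constantCoeff_opE] at h1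
  simp only [map_mul, map_sub, map_one] at h1 h2 h3
  linear_combination (1 + X) * h1 - (1 + X) * h2 - (1 + X) * h3

lemma opD_one (y : ℝ) : opD y 1 = y • (1 : ℝ⟦X⟧) := by
  refine mul_left_cancel₀ X_ne_zero ?_
  rw [X_mul_opD, smul_eq_C_mul]
  simp [mul_comm]

/-! ### Weights of words and their recursions -/

/-- The operator of a letter: `D` for a particle, `E` for an empty location. -/
noncomputable def op (x y : ℝ) (b : Bool) : ℝ⟦X⟧ →ₗ[ℝ] ℝ⟦X⟧ := if b then opD y else opE x y

/-- The product of the operators of the letters of a state, applied to the vector `1`. -/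
noncomputable def vec (x y : ℝ) : {n : ℕ} → State n → ℝ⟦X⟧
  | 0, _ => 1
  | _ + 1, τ => op x y (τ 0) (vec x y (Fin.tail τ))

/-- The matrix product weight of a state. -/
noncomputable def weight (x y : ℝ) {n : ℕ} (τ : State n) : ℝ := constantCoeff (vec x y τ)

lemma tail_removeNth_succ {n : ℕ} (τ : State (n + 2)) (i : Fin (n + 1)) :
    Fin.tail (i.succ.removeNth τ) = i.removeNth (Fin.tail τ) := by
  ext j
  simp [Fin.tail, Fin.removeNth]

lemma vec_removeNth_succ (x y : ℝ) {n : ℕ} (τ : State (n + 2)) (i : Fin (n + 1)) :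
    vec x y (i.succ.removeNth τ) = op x y (τ 0) (vec x y (i.removeNth (Fin.tail τ))) := by
  rw [vec, tail_removeNth_succ]
  rfl

/-- DE = D + E at the bond: the term D deletes the 0 and the term E deletes the 1. The letters to
the left act linearly, hence the induction. -/
lemma vec_hop (x y : ℝ) {n : ℕ} (τ : State (n + 2)) (i : Fin (n + 1))
    (h1 : τ i.castSucc = true) (h0 : τ i.succ = false) :
    vec x y τ = vec x y (i.succ.removeNth τ) + vec x y (i.castSucc.removeNth τ) := by
  induction n with
  | zero =>
    obtain rfl : i = 0 := Fin.ext (by omega)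
    have h1' : τ 0 = true := h1
    have h0' : τ 1 = false := h0
    simp [vec, op, Fin.tail, Fin.removeNth, h1', h0', opD_opE]
  | succ n ih =>
    induction i using Fin.cases with
    | zero =>
      have h1' : τ 0 = true := h1
      have h0' : τ 1 = false := h0
      have e : Fin.tail (Fin.removeNth (Fin.succ 0) τ) = Fin.tail (Fin.tail τ) := by
        rw [tail_removeNth_succ, Fin.removeNth_zero]
      rw [Fin.castSucc_zero, Fin.removeNth_zero]
      simp only [vec]
      rw [e]
      simp [op, Fin.tail, Fin.removeNth, h1', h0', opD_opE]
    | succ i =>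
      rw [vec, ih (Fin.tail τ) i h1 h0, map_add, ← Fin.succ_castSucc, vec_removeNth_succ x y τ,
        vec_removeNth_succ x y τ]

lemma vec_exit (x y : ℝ) {n : ℕ} (τ : State (n + 1)) (h : τ (Fin.last n) = true) :
    vec x y τ = y • vec x y ((Fin.last n).removeNth τ) := by
  induction n with
  | zero =>
    have h' : τ 0 = true := h
    simp [vec, op, h', opD_one]
  | succ n ih =>
    have := ih (Fin.tail τ) h
    rw [vec, this, ← Fin.succ_last, vec_removeNth_succ, map_smul]

lemma weight_hop (x y : ℝ) {n : ℕ} (τ : State (n + 2)) (i : Fin (n + 1))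
    (h1 : τ i.castSucc = true) (h0 : τ i.succ = false) :
    weight x y τ = weight x y (i.succ.removeNth τ) + weight x y (i.castSucc.removeNth τ) := by
  simp [weight, vec_hop x y τ i h1 h0]

lemma weight_exit (x y : ℝ) {n : ℕ} (τ : State (n + 1)) (h : τ (Fin.last n) = true) :
    weight x y τ = y * weight x y ((Fin.last n).removeNth τ) := by
  simp [weight, vec_exit x y τ h]

lemma weight_enter (x y : ℝ) {n : ℕ} (τ : State (n + 1)) (h : τ 0 = false) :
    weight x y τ = x * weight x y (Fin.removeNth 0 τ) := by
  simp [weight, vec, op, h, constantCoeff_opE, Fin.removeNth_zero]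

/-- A nonempty word ends in 1, starts with 0, or contains 10; each case writes its weight as a
positive combination of weights of shorter words. -/
lemma weight_pos {x y : ℝ} (hx : 0 < x) (hy : 0 < y) {n : ℕ} (τ : State n) : 0 < weight x y τ := by
  induction n with
  | zero => simp [weight, vec]
  | succ n ih =>
    by_cases hlast : τ (Fin.last n) = true
    · rw [weight_exit x y τ hlast]; exact mul_pos hy (ih _)
    by_cases hzero : τ 0 = false
    · rw [weight_enter x y τ hzero]; exact mul_pos hx (ih _)
    obtain _ | n := n
    · simp_all
    have : ∃ i : Fin (n + 1), τ i.castSucc = true ∧ τ i.succ = false := by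
      by_contra! hc
      refine hlast (Fin.induction (motive := fun i => τ i = true) (by simpa using hzero)
        (fun i hi => by simpa using hc i hi) (Fin.last (n + 1)))
    obtain ⟨i, h1, h0⟩ := this
    rw [weight_hop x y τ i h1 h0]
    exact add_pos (ih _) (ih _)

/-! ### Partition function -/

/-- The vectors `∑ E^q D^(p-q) V`, summed over `0 ≤ q ≤ p`. -/
noncomputable def orderedSum (x y : ℝ) : ℕ → ℝ⟦X⟧
  | 0 => 1
  | p + 1 => opE x y (orderedSum x y p) + y ^ (p + 1) • 1

lemma opC_orderedSum_zero (x y : ℝ) :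
    (opD y + opE x y) (orderedSum x y 0) = orderedSum x y 1 := by
  simp [orderedSum, opD_one, add_comm]

/-- Together with the case p = 0 this says that D + E sends the p-th ordered sum to the sum of those
of index 1 to p + 1. -/
lemma opC_orderedSum_succ (x y : ℝ) (p : ℕ) :
    (opD y + opE x y) (orderedSum x y (p + 1)) =
      (opD y + opE x y) (orderedSum x y p) + orderedSum x y (p + 2) := by
  conv_lhs => rw [LinearMap.add_apply]
  rw [orderedSum, map_add, opD_opE, orderedSum, orderedSum, map_smul, opD_one, smul_smul,
    ← pow_succ, LinearMap.add_apply]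
  abel

lemma constantCoeff_orderedSum (x y : ℝ) (p : ℕ) :
    constantCoeff (orderedSum x y p) = ∑ q ∈ Finset.range (p + 1), x ^ q * y ^ (p - q) := by
  induction p with
  | zero => simp [orderedSum]
  | succ p ih =>
    rw [orderedSum, map_add, constantCoeff_opE, ih, Finset.sum_range_succ' _ (p + 1),
      Finset.mul_sum]
    simp [pow_succ', mul_assoc]

/-- The ballot numbers, the coefficients of the partition function. -/
noncomputable def ballot (n p : ℕ) : ℝ :=
  (p : ℝ) / (2 * (n : ℝ) - p) * ((2 * n - p).choose n : ℝ)

/-- Writing n = p + d gives a factorial form without the truncated subtraction and the division by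
2n - p. -/
lemma ballot_add (p d : ℕ) (h : 1 ≤ p + d) :
    ballot (p + d) p = p * (p + 2 * d - 1).factorial / ((p + d).factorial * d.factorial) := by
  obtain ⟨m, hm⟩ : ∃ m, p + 2 * d = m + 1 := ⟨p + 2 * d - 1, by omega⟩
  have e : 2 * (p + d) - p = (p + d) + d := by omega
  have e2 : (p + d) + d = m + 1 := by omega
  have e3 : (2 * ((p + d : ℕ) : ℝ) - p) = m + 1 := by
    have : (p : ℝ) + 2 * d = m + 1 := by exact_mod_cast hm
    push_cast; linarith
  rw [ballot, e, Nat.choose_symm_add, Nat.add_choose, Nat.cast_div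
    (Nat.factorial_mul_factorial_dvd_factorial_add _ _) (by positivity), e2, e3, hm, Nat.factorial_succ]
  have : (m : ℝ) + 1 ≠ 0 := by positivity
  push_cast
  field_simp

lemma ballot_eq_zero {n p : ℕ} (hn : 1 ≤ n) (h : n < p) : ballot n p = 0 := by
  rw [ballot, Nat.choose_eq_zero_of_lt (by omega)]; simp

lemma ballot_succ {n p : ℕ} (hn : 1 ≤ n) (hp : p ≤ n) :
    ballot (n + 1) (p + 1) - ballot (n + 1) (p + 2) = ballot n p := by
  obtain ⟨d, rfl⟩ := Nat.exists_eq_add_of_le hp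
  rw [show p + d + 1 = (p + 1) + d by omega, ballot_add (p + 1) d (by omega),
    ballot_add p d hn]
  obtain _ | d := d
  · rw [ballot_eq_zero (by omega) (by omega)]
    obtain ⟨p, rfl⟩ := Nat.exists_eq_add_of_le' (show 1 ≤ p by omega)
    simp [Nat.factorial_succ]
    field_simp
  · rw [show p + 1 + (d + 1) = (p + 2) + d by omega, ballot_add (p + 2) d (by omega)]
    rw [show p + 1 + 2 * (d + 1) - 1 = p + 2 * d + 2 by omega,
      show p + 2 + 2 * d - 1 = p + 2 * d + 1 by omega,
      show p + 2 * (d + 1) - 1 = p + 2 * d + 1 by omega,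
      show p + 2 + d = p + d + 2 by omega, show p + (d + 1) = p + d + 1 by omega]
    simp only [Nat.factorial_succ]
    push_cast
    field_simp
    ring

/-- Summation by parts: it moves the recursion of the ordered sums onto the ballot numbers. The
boundary term vanishes in the application. -/
lemma sum_ballot_succ {M : Type*} [AddCommGroup M] [Module ℝ M] (s T : ℕ → M)
    (h0 : T 0 = s 1) (hs : ∀ p, T (p + 1) = T p + s (p + 2)) (b : ℕ → ℝ) (N : ℕ) :
    ∑ p ∈ Finset.range (N + 1), (b (p + 1) - b (p + 2)) • T p + b (N + 2) • T N =
      ∑ p ∈ Finset.range (N + 1), b (p + 1) • s (p + 1) := by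
  induction N with
  | zero => simp [h0, sub_smul]
  | succ N ih =>
    rw [Finset.sum_range_succ _ (N + 1), Finset.sum_range_succ _ (N + 1), ← ih, hs]
    module

lemma opC_pow (x y : ℝ) (n : ℕ) :
    ((opD y + opE x y) ^ (n + 1)) 1 =
      ∑ p ∈ Finset.range (n + 1), ballot (n + 1) (p + 1) • orderedSum x y (p + 1) := by
  induction n with
  | zero =>
    have : ballot 1 1 = 1 := by norm_num [ballot]
    simp [this, orderedSum, opD_one, add_comm]
  | succ n ih =>
    rw [pow_succ', Module.End.mul_apply, ih, map_sum,
      ← sum_ballot_succ (orderedSum x y) (fun p => (opD y + opE x y) (orderedSum x y p))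
        (opC_orderedSum_zero x y) (opC_orderedSum_succ x y) (ballot (n + 1 + 1)) (n + 1),
      ballot_eq_zero (by omega) (by omega), zero_smul, add_zero, Finset.sum_range_succ' _ (n + 1)]
    -- The extra term of index 0 vanishes because its coefficient is the ballot number with p = 0.
    have h0 : ballot (n + 1 + 1) (0 + 1) - ballot (n + 1 + 1) (0 + 2) = 0 := by
      rw [ballot_succ (by omega) (by omega)]; simp [ballot]
    rw [h0, zero_smul, add_zero]
    refine Finset.sum_congr rfl fun p hp => ?_
    rw [ballot_succ (by omega) (by simp at hp; omega), map_smul]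

lemma sum_vec (x y : ℝ) (n : ℕ) : ∑ τ : State n, vec x y τ = ((opD y + opE x y) ^ n) 1 := by
  induction n with
  | zero => simp [vec]
  | succ n ih =>
    rw [pow_succ', Module.End.mul_apply, ← ih, ← (Fin.consEquiv fun _ => Bool).sum_comp,
      Fintype.sum_prod_type]
    simp [vec, op, map_sum, Fin.consEquiv, Finset.sum_add_distrib]

lemma quot_eq (α β : ℝ) (p : ℕ) :
    quot α β p = ∑ q ∈ Finset.range (p + 1), α⁻¹ ^ q * β⁻¹ ^ (p - q) := by
  rw [quot]
  split_ifs with h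
  · subst h
    rw [Finset.sum_congr rfl (g := fun _ => α⁻¹ ^ p)]
    · simp
    · intro q hq
      rw [← pow_add]; congr 1; simp at hq; omega
  · have hne : α⁻¹ - β⁻¹ ≠ 0 := fun h0 => h (inv_injective (sub_eq_zero.mp h0))
    have e : ∀ a : ℝ, a ^ (-(p : ℤ) - 1) = a⁻¹ ^ (p + 1) := fun a => by
      rw [inv_pow, ← zpow_natCast, ← zpow_neg]; congr 1; push_cast; ring
    rw [div_eq_iff hne, e, e, ← Commute.geom_sum₂_mul (Commute.all _ _)]
    rfl

lemma Z_eq_sum_weight {n : ℕ} (hn : 1 ≤ n) (α β : ℝ) :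
    Z n α β = (α * β) ^ n * ∑ τ : State n, weight (1 / α) (1 / β) τ := by
  obtain ⟨n, rfl⟩ := Nat.exists_eq_add_of_le' hn
  have : ∑ τ : State (n + 1), weight (1 / α) (1 / β) τ =
      constantCoeff (∑ τ : State (n + 1), vec (1 / α) (1 / β) τ) := by
    rw [map_sum]; rfl
  rw [Z, this, sum_vec, opC_pow, map_sum, Finset.range_eq_Ico, Finset.sum_Ico_add' (fun p =>
    constantCoeff (ballot (n + 1) p • orderedSum (1 / α) (1 / β) p))]
  congr 1
  refine Finset.sum_congr (by ext; simp) fun p _ => ?_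
  rw [constantCoeff_smul, constantCoeff_orderedSum, quot_eq, ballot]
  simp

/-! ### Moves and balance equations -/

/-- The state after a hop over the bond `i`. -/
def hop {n : ℕ} (i : Fin n) (τ : State (n + 1)) : State (n + 1) :=
  Function.update (Function.update τ i.castSucc false) i.succ true

/-- The state before a hop over the bond `i`. -/
def unhop {n : ℕ} (i : Fin n) (τ : State (n + 1)) : State (n + 1) :=
  Function.update (Function.update τ i.castSucc true) i.succ false

lemma castSucc_ne_succ' {n : ℕ} (i : Fin n) : i.castSucc ≠ i.succ := Fin.castSucc_lt_succ.ne

lemma unhop_castSucc {n : ℕ} (i : Fin n) (τ : State (n + 1)) : unhop i τ i.castSucc = true := by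
  simp [unhop, castSucc_ne_succ']

lemma unhop_succ {n : ℕ} (i : Fin n) (τ : State (n + 1)) : unhop i τ i.succ = false := by
  simp [unhop]

lemma unhop_of_ne {n : ℕ} (i : Fin n) (τ : State (n + 1)) {j : Fin (n + 1)}
    (h1 : j ≠ i.castSucc) (h2 : j ≠ i.succ) : unhop i τ j = τ j := by
  simp [unhop, h1, h2]

lemma hop_castSucc {n : ℕ} (i : Fin n) (τ : State (n + 1)) : hop i τ i.castSucc = false := by
  simp [hop, castSucc_ne_succ']

lemma hop_succ {n : ℕ} (i : Fin n) (τ : State (n + 1)) : hop i τ i.succ = true := by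
  simp [hop]

lemma hop_of_ne {n : ℕ} (i : Fin n) (τ : State (n + 1)) {j : Fin (n + 1)}
    (h1 : j ≠ i.castSucc) (h2 : j ≠ i.succ) : hop i τ j = τ j := by
  simp [hop, h1, h2]

lemma hop_unhop {n : ℕ} (i : Fin n) (τ : State (n + 1)) (h0 : τ i.castSucc = false)
    (h1 : τ i.succ = true) : hop i (unhop i τ) = τ := by
  ext j
  rcases eq_or_ne j i.succ with rfl | h
  · rw [hop_succ, h1]
  rcases eq_or_ne j i.castSucc with rfl | h'
  · rw [hop_castSucc, h0]
  rw [hop_of_ne i _ h' h, unhop_of_ne i _ h' h]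

lemma unhop_hop {n : ℕ} (i : Fin n) (τ : State (n + 1)) (h1 : τ i.castSucc = true)
    (h0 : τ i.succ = false) : unhop i (hop i τ) = τ := by
  ext j
  rcases eq_or_ne j i.succ with rfl | h
  · rw [unhop_succ, h0]
  rcases eq_or_ne j i.castSucc with rfl | h'
  · rw [unhop_castSucc, h1]
  rw [unhop_of_ne i _ h' h, hop_of_ne i _ h' h]

lemma enters_iff {n : ℕ} (σ τ : State (n + 1)) :
    Enters σ τ ↔ σ 0 = false ∧ τ = Function.update σ 0 true := by
  constructor
  · rintro ⟨i, hi, h⟩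
    obtain rfl : i = 0 := Fin.ext hi
    exact h
  · exact fun h => ⟨0, rfl, h⟩

lemma enters_iff' {n : ℕ} (σ τ : State (n + 1)) :
    Enters σ τ ↔ τ 0 = true ∧ σ = Function.update τ 0 false := by
  rw [enters_iff]
  constructor <;> rintro ⟨h, rfl⟩ <;> simp [← h]

lemma exits_iff {n : ℕ} (σ τ : State (n + 1)) :
    Exits σ τ ↔ σ (Fin.last n) = true ∧ τ = Function.update σ (Fin.last n) false := by
  constructor
  · rintro ⟨i, hi, h⟩
    obtain rfl : i = Fin.last n := Fin.ext (by simpa using hi)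
    exact h
  · exact fun h => ⟨Fin.last n, rfl, h⟩

lemma exits_iff' {n : ℕ} (σ τ : State (n + 1)) :
    Exits σ τ ↔ τ (Fin.last n) = false ∧ σ = Function.update τ (Fin.last n) true := by
  rw [exits_iff]
  constructor <;> rintro ⟨h, rfl⟩ <;> simp [← h]

lemma hops_iff {n : ℕ} (σ τ : State (n + 1)) :
    Hops σ τ ↔ ∃ i : Fin n, (σ i.castSucc = true ∧ σ i.succ = false) ∧ τ = hop i σ := by
  constructor
  · rintro ⟨i, j, hij, h1, h0, h⟩
    obtain ⟨i, rfl⟩ : ∃ i' : Fin n, i = i'.castSucc := ⟨⟨i, by omega⟩, rfl⟩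
    obtain rfl : j = i.succ := Fin.ext hij
    exact ⟨i, ⟨h1, h0⟩, h⟩
  · rintro ⟨i, ⟨h1, h0⟩, h⟩
    exact ⟨i.castSucc, i.succ, by simp, h1, h0, h⟩

lemma hops_iff' {n : ℕ} (σ τ : State (n + 1)) :
    Hops σ τ ↔ ∃ i : Fin n, (τ i.castSucc = false ∧ τ i.succ = true) ∧ σ = unhop i τ := by
  rw [hops_iff]
  constructor
  · rintro ⟨i, ⟨h1, h0⟩, rfl⟩
    exact ⟨i, ⟨hop_castSucc i σ, hop_succ i σ⟩, (unhop_hop i σ h1 h0).symm⟩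
  · rintro ⟨i, ⟨h1, h0⟩, rfl⟩
    exact ⟨i, ⟨unhop_castSucc i τ, unhop_succ i τ⟩, (hop_unhop i τ h1 h0).symm⟩

lemma hop_injective {n : ℕ} {τ : State (n + 1)} {i j : Fin n}
    (hi : τ i.castSucc = true ∧ τ i.succ = false) (hj : τ j.castSucc = true ∧ τ j.succ = false)
    (h : hop i τ = hop j τ) : i = j := by
  by_contra hne
  have h1 := congrFun h i.castSucc
  have hc : i.castSucc ≠ j.succ := fun h => by simp [h, hj.2] at hi
  rw [hop_castSucc, hop_of_ne j τ (by simpa using hne) hc, hi.1] at h1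
  simp at h1

lemma unhop_injective {n : ℕ} {τ : State (n + 1)} {i j : Fin n}
    (hi : τ i.castSucc = false ∧ τ i.succ = true) (hj : τ j.castSucc = false ∧ τ j.succ = true)
    (h : unhop i τ = unhop j τ) : i = j := by
  by_contra hne
  have h1 := congrFun h i.castSucc
  have hc : i.castSucc ≠ j.succ := fun h => by simp [h, hj.2] at hi
  rw [unhop_castSucc, unhop_of_ne j τ (by simpa using hne) hc, hi.1] at h1
  simp at h1

open Classical in
-- Turns a sum over states joined by a hop into a sum over bonds; injectivity ensures that no state
-- is counted twice.
lemma sum_ite_exists_eq {S I : Type*} [Fintype S] [Fintype I] (P : I → Prop) [DecidablePred P] (φ : I → S)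
    (hφ : ∀ i j, P i → P j → φ i = φ j → i = j) (g : S → ℝ) :
    ∑ s, (if ∃ i, P i ∧ s = φ i then g s else 0) = ∑ i, if P i then g (φ i) else 0 := by
  have key : ∀ s, (if ∃ i, P i ∧ s = φ i then g s else 0) =
      ∑ i, if P i ∧ s = φ i then g s else 0 := fun s => by
    split_ifs with h
    · obtain ⟨i, hi, rfl⟩ := h
      rw [Finset.sum_eq_single i]
      · simp [hi]
      · intro j _ hj
        exact if_neg fun h => hj (hφ j i h.1 hi h.2.symm)
      · simp
    · exact (Finset.sum_eq_zero fun i _ => if_neg fun hi => h ⟨i, hi⟩).symm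
  simp_rw [key]
  rw [Finset.sum_comm]
  refine Finset.sum_congr rfl fun i _ => ?_
  by_cases h : P i <;> simp [h]

lemma sum_mul_rate_left {n : ℕ} (α β : ℝ) (g : State (n + 1) → ℝ) (τ : State (n + 1)) :
    ∑ σ, g σ * rate α β σ τ =
      (if τ 0 = true then g (Function.update τ 0 false) * α else 0) +
      (if τ (Fin.last n) = false then g (Function.update τ (Fin.last n) true) * β else 0) +
      ∑ i : Fin n, if τ i.castSucc = false ∧ τ i.succ = true then g (unhop i τ) else 0 := by
  classical
  rw [← sum_ite_exists_eq (fun i : Fin n => τ i.castSucc = false ∧ τ i.succ = true)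
    (fun i => unhop i τ) (fun i j => unhop_injective) g]
  simp only [rate, mul_add, Finset.sum_add_distrib, enters_iff', exits_iff', hops_iff', mul_ite,
    mul_zero, mul_one, ite_and]
  congr 2
  · split_ifs <;> simp
  · split_ifs <;> simp
  · congr!

lemma sum_rate_right {n : ℕ} (α β : ℝ) (τ : State (n + 1)) :
    ∑ ρ, rate α β τ ρ =
      (if τ 0 = false then α else 0) + (if τ (Fin.last n) = true then β else 0) +
      ∑ i : Fin n, if τ i.castSucc = true ∧ τ i.succ = false then 1 else 0 := by
  classical
  rw [← sum_ite_exists_eq (fun i : Fin n => τ i.castSucc = true ∧ τ i.succ = false)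
    (fun i => hop i τ) (fun i j => hop_injective) fun _ => 1]
  simp only [rate, Finset.sum_add_distrib, enters_iff, exits_iff, hops_iff, ite_and]
  congr 2
  · split_ifs <;> simp
  · split_ifs <;> simp
  · congr!

lemma rate_self {n : ℕ} (α β : ℝ) (τ : State (n + 1)) : rate α β τ τ = 0 := by
  have h1 : ¬ Enters τ τ := by
    rw [enters_iff]
    rintro ⟨h, h'⟩
    have := congrFun h' 0
    simp [h] at this
  have h2 : ¬ Exits τ τ := by
    rw [exits_iff]
    rintro ⟨h, h'⟩
    have := congrFun h' (Fin.last n)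
    simp [h] at this
  have h3 : ¬ Hops τ τ := by
    rw [hops_iff]
    rintro ⟨i, ⟨h, -⟩, h'⟩
    have := congrFun h' i.castSucc
    rw [h, hop_castSucc] at this
    simp at this
  simp [rate, h1, h2, h3]

/-- The balance equations: at every state the inflow equals the outflow. -/
def IsBalanced {n : ℕ} (α β : ℝ) (π : State n → ℝ) : Prop :=
  ∀ τ, ∑ σ, π σ * rate α β σ τ = π τ * ∑ ρ, rate α β τ ρ

/-- Only linear algebra is involved, so the sign of the diagonal entries plays no role. -/
lemma vecMul_transition_eq_iff {n : ℕ} (α β : ℝ) (π : State (n + 1) → ℝ) :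
    Matrix.vecMul π (transition (n + 1) α β) = π ↔ IsBalanced α β π := by
  rw [funext_iff]
  refine forall_congr' fun τ => ?_
  have hN : ((n + 1 : ℕ) : ℝ) + 1 ≠ 0 := by positivity
  have h1 : ∑ ρ ∈ Finset.univ.erase τ, rate α β τ ρ / (((n + 1 : ℕ) : ℝ) + 1) =
      (∑ ρ, rate α β τ ρ) / (((n + 1 : ℕ) : ℝ) + 1) := by
    rw [← Finset.add_sum_erase Finset.univ _ (Finset.mem_univ τ), rate_self, zero_add,
      Finset.sum_div]
  have h2 : Matrix.vecMul π (transition (n + 1) α β) τ =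
      π τ * (1 - (∑ ρ, rate α β τ ρ) / (((n + 1 : ℕ) : ℝ) + 1)) +
        (∑ σ, π σ * rate α β σ τ) / (((n + 1 : ℕ) : ℝ) + 1) := by
    rw [← h1, Matrix.vecMul, dotProduct, ← Finset.add_sum_erase Finset.univ _ (Finset.mem_univ τ),
      ← Finset.add_sum_erase Finset.univ (fun σ => π σ * rate α β σ τ) (Finset.mem_univ τ),
      rate_self, mul_zero, zero_add, Finset.sum_div]
    congr 1
    · simp [transition]
    · refine Finset.sum_congr rfl fun σ hσ => ?_
      simp [transition, (Finset.ne_of_mem_erase hσ).symm, mul_div_assoc]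
  rw [h2]
  field_simp
  constructor <;> intro h <;> linarith

lemma removeNth_castSucc_eq_removeNth_succ {n : ℕ} {σ τ : State (n + 1)} {i : Fin n}
    (h : σ i.succ = τ i.castSucc) (hne : ∀ j, j ≠ i.castSucc → j ≠ i.succ → σ j = τ j) :
    i.castSucc.removeNth σ = i.succ.removeNth τ := by
  ext j
  rw [Fin.removeNth, Fin.removeNth]
  rcases lt_trichotomy j i with hj | rfl | hj
  · rw [Fin.succAbove_of_castSucc_lt _ _ (by simpa using hj),
      Fin.succAbove_of_castSucc_lt _ _ (Fin.lt_def.mpr (by have := Fin.lt_def.mp hj; simp; omega))]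
    exact hne _ (by simpa using hj.ne) (Fin.ne_of_val_ne (by have := Fin.lt_def.mp hj; simp; omega))
  · simp [h]
  · rw [Fin.succAbove_of_le_castSucc _ _ (by simpa using hj.le),
      Fin.succAbove_of_le_castSucc _ _ (by simpa [Fin.le_def] using hj)]
    exact hne _ (by simp [Fin.ext_iff]; omega) (by simpa using hj.ne')

lemma weight_bond (x y : ℝ) {n : ℕ} (τ : State (n + 1)) (i : Fin n)
    (h1 : τ i.castSucc = true) (h0 : τ i.succ = false) :
    weight x y τ = weight x y (i.succ.removeNth τ) + weight x y (i.castSucc.removeNth τ) := by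
  obtain _ | n := n
  · exact i.elim0
  · exact weight_hop x y τ i h1 h0

/-- The pairs 10 and 01 differ by a swap, so deleting one site before the hop equals deleting the
other site after it. -/
lemma weight_unhop (x y : ℝ) {n : ℕ} (τ : State (n + 1)) (i : Fin n)
    (h0 : τ i.castSucc = false) (h1 : τ i.succ = true) :
    weight x y (unhop i τ) =
      weight x y (i.castSucc.removeNth τ) + weight x y (i.succ.removeNth τ) := by
  rw [weight_bond x y _ i (unhop_castSucc i τ) (unhop_succ i τ),
    removeNth_castSucc_eq_removeNth_succ (σ := unhop i τ) (τ := τ)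
      (by rw [unhop_succ, h0]) (fun j => unhop_of_ne i τ),
    removeNth_castSucc_eq_removeNth_succ (σ := τ) (τ := unhop i τ)
      (by rw [unhop_castSucc, h1]) (fun j hj hj' => (unhop_of_ne i τ hj hj').symm)]

/-- The sign `-1` of a particle and `1` of an empty location. -/
def sgn (b : Bool) : ℝ := if b then -1 else 1

lemma isBalanced_weight {n : ℕ} {α β : ℝ} (hα : 0 < α) (hβ : 0 < β) :
    IsBalanced α β (fun τ : State (n + 1) => weight (1 / α) (1 / β) τ) := by
  intro τ
  set x := 1 / α with hx
  set y := 1 / β with hy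
  -- Signed weights of the word with one site deleted: the bond i has net inflow c_i - c_{i+1}, and
  -- the two ends cancel what remains after telescoping.
  let c : Fin (n + 1) → ℝ := fun i => sgn (τ i) * weight x y (i.removeNth τ)
  have tele : ∑ i : Fin n, (c i.castSucc - c i.succ) = c 0 - c (Fin.last n) := by
    have h1 := Fin.sum_univ_castSucc c
    have h2 := Fin.sum_univ_succ c
    rw [Finset.sum_sub_distrib]
    linarith
  have hxα : x * α = 1 := by rw [hx]; field_simp
  have hyβ : y * β = 1 := by rw [hy]; field_simp
  have left : (if τ 0 = true then weight x y (Function.update τ 0 false) * α else 0) -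
      weight x y τ * (if τ 0 = false then α else 0) = - c 0 := by
    cases h : τ 0
    · simp [c, sgn, h]
      rw [weight_enter x y τ h, Fin.removeNth_zero]
      linear_combination (weight x y (Fin.tail τ)) * hxα
    · simp [c, sgn, h]
      rw [weight_enter x y _ (Function.update_self ..), Fin.removeNth_update, Fin.removeNth_zero]
      linear_combination (weight x y (Fin.tail τ)) * hxα
  have right : (if τ (Fin.last n) = false then
        weight x y (Function.update τ (Fin.last n) true) * β else 0) -
      weight x y τ * (if τ (Fin.last n) = true then β else 0) = c (Fin.last n) := by
    cases h : τ (Fin.last n)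
    · simp only [c, sgn, h, if_true]
      rw [weight_exit x y _ (Function.update_self ..), Fin.removeNth_update, Fin.removeNth_last]
      simp
      linear_combination (weight x y (Fin.init τ)) * hyβ
    · simp only [c, sgn, h, if_true]
      rw [weight_exit x y τ h, Fin.removeNth_last]
      simp
      linear_combination (weight x y (Fin.init τ)) * hyβ
  have bulk : ∑ i : Fin n, (if τ i.castSucc = false ∧ τ i.succ = true then
        weight x y (unhop i τ) else 0) -
      weight x y τ * ∑ i : Fin n, (if τ i.castSucc = true ∧ τ i.succ = false then 1 else 0) =
      ∑ i : Fin n, (c i.castSucc - c i.succ) := by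
    rw [Finset.mul_sum, ← Finset.sum_sub_distrib]
    refine Finset.sum_congr rfl fun i _ => ?_
    -- For equal letters no hop crosses the bond, and deleting either site gives the same word.
    cases h : τ i.castSucc <;> cases h' : τ i.succ
    · simp [c, sgn, h, h',
        removeNth_castSucc_eq_removeNth_succ (h'.trans h.symm) fun _ _ _ => rfl]
    · simp [c, sgn, h, h', weight_unhop x y τ i h h']
    · simp [c, sgn, h, h', weight_bond x y τ i h h']
      ring
    · simp [c, sgn, h, h',
        removeNth_castSucc_eq_removeNth_succ (h'.trans h.symm) fun _ _ _ => rfl]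
  rw [sum_mul_rate_left, sum_rate_right]
  linarith

/-! ### Determinant formula -/

/-- The matrix of coefficients `[X^(j-i+1)] c_j` in the first `k` columns, and `[X^(k-i)] h` in the
last one. -/
noncomputable def hess (k : ℕ) (c : ℕ → ℝ⟦X⟧) (h : ℝ⟦X⟧) : Matrix (Fin (k + 1)) (Fin (k + 1)) ℝ :=
  Matrix.updateCol
    (Matrix.of fun i j => if (i : ℕ) ≤ j + 1 then coeff ((j : ℕ) + 1 - i) (c j) else 0)
    (Fin.last k) fun i => coeff (k - i) h

lemma hess_castSucc (k : ℕ) (c : ℕ → ℝ⟦X⟧) (h : ℝ⟦X⟧) (i : Fin (k + 1)) (j : Fin k) :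
    hess k c h i j.castSucc = if (i : ℕ) ≤ j + 1 then coeff ((j : ℕ) + 1 - i) (c j) else 0 := by
  rw [hess, Matrix.updateCol_ne (Fin.castSucc_lt_last j).ne]
  simp

lemma hess_last (k : ℕ) (c : ℕ → ℝ⟦X⟧) (h : ℝ⟦X⟧) (i : Fin (k + 1)) :
    hess k c h i (Fin.last k) = coeff (k - i) h := by
  simp [hess]

lemma det_hess_smul_sub (k : ℕ) (c : ℕ → ℝ⟦X⟧) (r : ℝ) (h h' : ℝ⟦X⟧) :
    (hess k c (r • h - h')).det = r * (hess k c h).det - (hess k c h').det := by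
  have e : (fun i : Fin (k + 1) => coeff (k - (i : ℕ)) (r • h - h')) =
      (r • fun i : Fin (k + 1) => coeff (k - (i : ℕ)) h) +
        (-1 : ℝ) • fun i : Fin (k + 1) => coeff (k - (i : ℕ)) h' := by
    ext i; simp [sub_eq_add_neg]
  rw [hess, e, Matrix.det_updateCol_add, Matrix.det_updateCol_smul, Matrix.det_updateCol_smul]
  simp [hess, sub_eq_add_neg]

/-- The last row has at most two nonzero entries, the subdiagonal 1 and the constant term of h.
Laplace expansion along it leaves two minors differing only in the last column, which recombine by
linearity. -/
lemma det_hess_succ (k : ℕ) (c : ℕ → ℝ⟦X⟧) (h : ℝ⟦X⟧) (hc : constantCoeff (c k) = 1) :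
    (hess (k + 1) c h).det =
      (hess k c (constantCoeff h • shift (c k) - shift h)).det := by
  rw [det_hess_smul_sub, Matrix.det_succ_row _ (Fin.last (k + 1)), Fin.sum_univ_castSucc,
    Fin.sum_univ_castSucc, Finset.sum_eq_zero]
  · have e1 : (hess (k + 1) c h).submatrix (Fin.last (k + 1)).succAbove
        (Fin.last (k + 1)).succAbove = hess k c (shift (c k)) := by
      ext i j
      rw [Matrix.submatrix_apply, Fin.succAbove_last, hess_castSucc]
      induction j using Fin.lastCases with
      | last =>
        have : (i : ℕ) ≤ k + 1 := by omega
        rw [hess_last, coeff_shift]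
        simp [this, show k + 1 - (i : ℕ) = k - i + 1 by omega]
      | cast j => rw [hess_castSucc]; simp
    have e2 : (hess (k + 1) c h).submatrix (Fin.last (k + 1)).succAbove
        (Fin.last k).castSucc.succAbove = hess k c (shift h) := by
      ext i j
      rw [Matrix.submatrix_apply, Fin.succAbove_last]
      induction j using Fin.lastCases with
      | last =>
        rw [hess_last, coeff_shift]
        simp [hess_last, show k + 1 - (i : ℕ) = k - i + 1 by omega]
      | cast j =>
        rw [hess_castSucc, Fin.succAbove_of_castSucc_lt _ _ (by simp [Fin.lt_def]), hess_castSucc]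
        simp
    rw [e1, e2, hess_last, hess_castSucc]
    have s1 : (-1 : ℝ) ^ (k + 1 + k) = -1 := by
      rw [show k + 1 + k = 2 * k + 1 by ring, pow_succ, pow_mul]; simp
    have s2 : (-1 : ℝ) ^ (k + 1 + (k + 1)) = 1 := by
      rw [← two_mul, pow_mul]; simp
    simp [hc, s1, s2]
    ring
  · intro j _
    rw [hess_castSucc, if_neg (by simp)]
    simp

/-- The column series of the matrix `A`, for consecutive parts `s + m` and `s`. -/
noncomputable def colSeries (x y : ℝ) (s m : ℕ) : ℝ⟦X⟧ :=
  (1 + C y * X) * (1 + X) ^ s * (1 + C x * X * ∑ p ∈ Finset.range m, (C x * (1 + X)) ^ p)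

lemma constantCoeff_colSeries (x y : ℝ) (s m : ℕ) : constantCoeff (colSeries x y s m) = 1 := by
  simp [colSeries]

lemma coeff_one_add_X_pow (s r : ℕ) : coeff r ((1 + X : ℝ⟦X⟧) ^ s) = s.choose r := by
  have : ((1 + X : ℝ⟦X⟧) ^ s) = (((1 + Polynomial.X) ^ s : Polynomial ℝ) : ℝ⟦X⟧) := by simp
  rw [this, Polynomial.coeff_coe, Polynomial.coeff_one_add_X_pow]

/-- The state vector of the determinant, built from right to left over the particles. -/
noncomputable def detVec (x y : ℝ) : {n : ℕ} → State n → ℝ⟦X⟧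
  | 0, _ => 1
  | _ + 1, τ =>
    let u := Fin.tail τ
    let f := detVec x y u
    if τ 0 then constantCoeff f • shift (colSeries x y (lam u 1) (lam u 0 - lam u 1)) - shift f
    else f

lemma filter_lt_zero_card {n : ℕ} (τ : State (n + 1)) :
    (Finset.univ.filter fun r : Fin (n + 1) => r < 0 ∧ τ r = true).card = 0 := by
  simp

lemma filter_lt_succ_card {n : ℕ} (τ : State (n + 1)) (s : Fin n) :
    (Finset.univ.filter fun r : Fin (n + 1) => r < s.succ ∧ τ r = true).card =
      (if τ 0 = true then 1 else 0) +
        (Finset.univ.filter fun r : Fin n => r < s ∧ Fin.tail τ r = true).card := by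
  simp only [Finset.card_filter]
  rw [Fin.sum_univ_succ]
  simp [Fin.tail]
  rw [Finset.card_filter]
  congr!

/-- The truncated subtraction is right at i = 0, since `lam τ 0` counts all zeros. -/
lemma lam_succ {n : ℕ} (τ : State (n + 1)) (i : ℕ) :
    lam τ i = (if τ 0 = false ∧ i = 0 then 1 else 0) +
      lam (Fin.tail τ) (i - if τ 0 = true then 1 else 0) := by
  rw [lam, lam]
  simp only [Finset.card_filter]
  rw [Fin.sum_univ_succ]
  simp only [← Finset.card_filter, filter_lt_zero_card, filter_lt_succ_card]
  simp only [Nat.le_zero, Fin.tail, Nat.sub_le_iff_le_add, add_comm]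
  congr!

lemma numParticles_succ {n : ℕ} (τ : State (n + 1)) :
    numParticles τ = (if τ 0 = true then 1 else 0) + numParticles (Fin.tail τ) := by
  rw [numParticles, numParticles]
  simp only [Finset.card_filter]
  rw [Fin.sum_univ_succ]
  rfl

lemma lam_antitone {n : ℕ} (τ : State n) : Antitone (lam τ) := fun _ _ hij =>
  Finset.card_le_card (Finset.monotone_filter_right _ fun _ _ h => ⟨h.1, hij.trans h.2⟩)

/-- The power of 1 + X clears the denominators of all the E's. `detVec` ignores the `lam τ 0 - lam τ
1` zeros before the first particle; they contribute the geometric sum and the power of x. -/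
lemma vec_eq_detVec (x y : ℝ) {n : ℕ} (τ : State n) :
    (1 + X) ^ lam τ 0 * vec x y τ = detVec x y τ +
        C ((x - 1) * constantCoeff (detVec x y τ)) * (1 + C y * X) * (1 + X) ^ lam τ 1 *
          ∑ p ∈ Finset.range (lam τ 0 - lam τ 1), (C x * (1 + X)) ^ p ∧
      constantCoeff (vec x y τ) = x ^ (lam τ 0 - lam τ 1) * constantCoeff (detVec x y τ) := by
  induction n with
  | zero => simp [vec, detVec, lam]
  | succ n ih =>
    obtain ⟨ih1, ih2⟩ := ih (Fin.tail τ)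
    set u := Fin.tail τ with hu
    set f := detVec x y u with hf
    obtain ⟨m, hm⟩ := Nat.exists_eq_add_of_le (lam_antitone u zero_le_one)
    have hm' : lam u 0 - lam u 1 = m := by omega
    rw [hm'] at ih1 ih2
    -- When D is applied, this turns the correction term into 1 + xX·(geometric sum), the last
    -- factor of `colSeries`.
    have geom : (C x * (1 + X) : ℝ⟦X⟧) ^ m =
        1 + (C x * (1 + X) - 1) * ∑ p ∈ Finset.range m, (C x * (1 + X)) ^ p := by
      rw [mul_geom_sum]; ring
    cases h0 : τ 0
    · have l0 : lam τ 0 = lam u 0 + 1 := by rw [lam_succ]; simp [h0, add_comm, hu]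
      have l1 : lam τ 1 = lam u 1 := by rw [lam_succ]; simp [h0, hu]
      have hv : vec x y τ = opE x y (vec x y u) := by rw [vec]; simp [op, h0, hu]
      have hd : detVec x y τ = f := by rw [detVec]; simp [h0, hf, hu]
      have hE := one_add_X_mul_opE x y (vec x y u)
      rw [hv, hd, l0, l1, show lam u 0 + 1 - lam u 1 = m + 1 by omega, constantCoeff_opE, ih2]
      refine ⟨?_, by ring⟩
      rw [ih2] at hE
      rw [Finset.sum_range_succ, mul_pow _ _ m]
      rw [hm] at ih1 ⊢
      simp only [map_mul, map_pow] at hE ih1 ⊢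
      linear_combination (1 + X) ^ (lam u 1 + m) * hE + ih1
    · have l0 : lam τ 0 = lam u 0 := by rw [lam_succ]; simp [h0, hu]
      have l1 : lam τ 1 = lam u 0 := by rw [lam_succ]; simp [h0, hu]
      have hv : vec x y τ = opD y (vec x y u) := by rw [vec]; simp [op, h0, hu]
      have hd : detVec x y τ =
          constantCoeff f • shift (colSeries x y (lam u 1) m) - shift f := by
        rw [detVec]; simp [h0, hf, ← hu, hm']
      have key : (1 + X) ^ lam u 0 * opD y (vec x y u) =
          constantCoeff f • shift (colSeries x y (lam u 1) m) - shift f := by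
        refine mul_left_cancel₀ X_ne_zero ?_
        have hD := X_mul_opD y (vec x y u)
        have hs := X_mul_shift f
        have hs' := X_mul_shift (colSeries x y (lam u 1) m)
        rw [constantCoeff_colSeries] at hs'
        rw [ih2] at hD
        rw [mul_sub, smul_eq_C_mul]
        rw [hm] at ih1 ⊢
        simp only [map_mul, map_pow, map_sub, map_one] at hD ih1 hs' ⊢
        rw [colSeries] at hs' ⊢
        rw [mul_pow] at geom
        linear_combination (1 + X) ^ (lam u 1 + m) * hD - ih1 - C (constantCoeff f) * hs' + hs +
          C (constantCoeff f) * (1 + C y * X) * (1 + X) ^ lam u 1 * geom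
      have hcc := congrArg constantCoeff key
      rw [hv, hd, l0, l1, ← key]
      simp

/-- The columns of the matrix of `τ`, indexed from `0`. -/
noncomputable def cols (x y : ℝ) (l : ℕ → ℕ) (j : ℕ) : ℝ⟦X⟧ :=
  colSeries x y (l (j + 2)) (l (j + 1) - l (j + 2))

/-- Each particle strips one column, from the right end of the word, by `det_hess_succ`. The k
leading columns are arbitrary so that the induction can pass a particle of the word to the prefix.
-/
lemma det_hess_append {n : ℕ} (x y : ℝ) (τ : State n) (k : ℕ) (c : ℕ → ℝ⟦X⟧)
    (hc : ∀ j, c (k + j) = cols x y (lam τ) j) :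
    (hess (k + numParticles τ) c 1).det = (hess k c (detVec x y τ)).det := by
  induction n generalizing k with
  | zero =>
    have h0 : numParticles τ = 0 := rfl
    rw [h0]
    rfl
  | succ n ih =>
    set u := Fin.tail τ with hu
    cases h0 : τ 0
    · have hn : numParticles τ = numParticles u := by rw [numParticles_succ]; simp [h0, hu]
      have hd : detVec x y τ = detVec x y u := by rw [detVec]; simp [h0, hu]
      have hl : ∀ j, lam τ (j + 1) = lam u (j + 1) := fun j => by rw [lam_succ]; simp [h0, hu]
      rw [hn, hd]
      exact ih u k fun j => by rw [hc, cols, cols, hl, hl]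
    · have hn : numParticles τ = numParticles u + 1 := by
        rw [numParticles_succ]; simp [h0, hu, add_comm]
      have hl : ∀ j, lam τ (j + 1) = lam u j := fun j => by rw [lam_succ]; simp [h0, hu]
      have hk : c k = colSeries x y (lam u 1) (lam u 0 - lam u 1) := by
        rw [← add_zero k, hc, cols, hl, hl]
      have hd : detVec x y τ = constantCoeff (detVec x y u) • shift (c k) -
          shift (detVec x y u) := by
        rw [detVec]; simp [h0, ← hu, hk]
      rw [hn, hd, ← det_hess_succ k c _ (by rw [hk, constantCoeff_colSeries]),
        show k + (numParticles u + 1) = k + 1 + numParticles u by ring]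
      exact ih u (k + 1) fun j => by
        rw [show k + 1 + j = k + (j + 1) by ring, hc, cols, cols, hl, hl]

lemma coeff_colSeries_succ (x y : ℝ) (s m r : ℕ) :
    coeff (r + 1) (colSeries x y s m) = (s.choose (r + 1) + y * s.choose r) +
      ∑ p ∈ Finset.Icc 1 m, x ^ p * ((s + p - 1).choose r +
        y * (binom (s + p - 1) ((r : ℤ) - 1) : ℝ)) := by
  have e : colSeries x y s m = (1 + X) ^ s + C y * (X * (1 + X) ^ s) +
      ∑ p ∈ Finset.range m, (C (x ^ (p + 1)) * (X * (1 + X) ^ (s + p)) +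
        C (x ^ (p + 1) * y) * (X * (X * (1 + X) ^ (s + p)))) := by
    rw [colSeries, mul_add, mul_one, Finset.mul_sum, Finset.mul_sum]
    congr 1
    · ring
    · refine Finset.sum_congr rfl fun p _ => ?_
      simp only [map_mul, map_pow, mul_pow]; ring
  have hb : ∀ a : ℕ, coeff r (X * (1 + X) ^ a : ℝ⟦X⟧) = (binom a ((r : ℤ) - 1) : ℝ) := by
    intro a
    obtain _ | r := r
    · simp [binom]
    · rw [coeff_succ_X_mul, coeff_one_add_X_pow]
      simp [binom]
  rw [e, map_add, map_add, map_sum, coeff_C_mul, coeff_succ_X_mul, coeff_one_add_X_pow,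
    coeff_one_add_X_pow, Finset.range_eq_Ico]
  congr 1
  have : Finset.Icc 1 m = Finset.Ico (0 + 1) (m + 1) := by ext; simp
  rw [this, ← Finset.sum_Ico_add']
  refine Finset.sum_congr rfl fun p _ => ?_
  rw [map_add, coeff_C_mul, coeff_C_mul, coeff_succ_X_mul, coeff_succ_X_mul, hb,
    coeff_one_add_X_pow, show s + (p + 1) - 1 = s + p by omega]
  ring

lemma entry_eq (α β : ℝ) (l : ℕ → ℕ) (i j : ℕ) :
    entry α β l (i + 1) (j + 1) =
      if i ≤ j + 1 then coeff (j + 1 - i) (cols (1 / α) (1 / β) l j) else 0 := by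
  rw [entry, cols]
  rcases lt_trichotomy i (j + 1) with h | h | h
  · obtain ⟨r, rfl⟩ := Nat.exists_eq_add_of_le (Nat.lt_succ_iff.mp h)
    rw [if_pos h.le, show i + r + 1 - i = r + 1 by omega, coeff_colSeries_succ]
    have e1 : (((i + r + 1 : ℕ) : ℤ) - ((i + 1 : ℕ) : ℤ)) = r := by push_cast; ring
    have e2 : ∀ a, binom a ((r : ℤ) + 1) = a.choose (r + 1) := fun a => by
      rw [binom, if_neg (by omega)]; rfl
    have e3 : ∀ a, binom a (r : ℤ) = a.choose r := fun a => by
      rw [binom, if_neg (by omega)]; rfl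
    simp only [e1, e2, e3]
  -- The subdiagonal: every binomial with negative lower index vanishes, and the entry is the
  -- constant term 1.
  · subst h
    have e1 : (((j + 1 : ℕ) : ℤ) - ((j + 1 + 1 : ℕ) : ℤ)) = -1 := by push_cast; ring
    simp only [e1]
    simp [binom, constantCoeff_colSeries]
  · rw [if_neg (by omega)]
    have e : ∀ a (r : ℤ), r < 0 → binom a r = 0 := fun a r hr => if_pos hr
    simp [e _ ((j : ℤ) - i) (by omega),
      e _ ((j : ℤ) - i + 1) (by omega),
      e _ ((j : ℤ) - i - 1) (by omega)]

/-- The border of the series 1 is the last basis vector. -/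
lemma det_hess_one (k : ℕ) (c : ℕ → ℝ⟦X⟧) :
    (hess k c 1).det = (Matrix.of fun i j : Fin k =>
      if (i : ℕ) ≤ j + 1 then coeff ((j : ℕ) + 1 - i) (c j) else 0).det := by
  rw [Matrix.det_succ_column _ (Fin.last k), Fin.sum_univ_castSucc, Finset.sum_eq_zero]
  · have s : (-1 : ℝ) ^ (k + k) = 1 := by rw [← two_mul, pow_mul]; simp
    rw [hess_last]
    simp only [Fin.val_last, s, Fin.succAbove_last, zero_add, one_mul, Nat.sub_self,
      coeff_zero_one]
    congr 1
    ext i j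
    rw [Matrix.submatrix_apply, hess_castSucc]
    simp
  · intro i _
    rw [hess_last, coeff_one, if_neg (by simp; omega)]
    simp

lemma det_matrixA (α β : ℝ) {n : ℕ} (τ : State n) :
    (matrixA α β τ).det = constantCoeff (detVec (1 / α) (1 / β) τ) := by
  have h := det_hess_append (1 / α) (1 / β) τ 0 (cols (1 / α) (1 / β) (lam τ))
    fun j => by rw [zero_add]
  rw [zero_add, det_hess_one] at h
  have h0 : (hess 0 (cols (1 / α) (1 / β) (lam τ)) (detVec (1 / α) (1 / β) τ)).det =
      constantCoeff (detVec (1 / α) (1 / β) τ) := by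
    rw [Matrix.det_fin_one]
    exact (hess_last 0 _ _ 0).trans (by simp)
  rw [← h0, ← h]
  congr 1
  ext i j
  rw [matrixA, Matrix.of_apply, Matrix.of_apply, entry_eq]

lemma numParticles_add_lam_zero {n : ℕ} (τ : State n) : numParticles τ + lam τ 0 = n := by
  simp only [numParticles, lam, zero_le, and_true]
  have := Finset.card_filter_add_card_filter_not (s := Finset.univ) fun s : Fin n => τ s = true
  simpa using this

lemma weight_eq_det {α : ℝ} (hα : 0 < α) (β : ℝ) {n : ℕ} (τ : State n) :
    α ^ n * weight (1 / α) (1 / β) τ =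
      α ^ (numParticles τ + lam τ 1) * (matrixA α β τ).det := by
  obtain ⟨m, hm⟩ := Nat.exists_eq_add_of_le (lam_antitone τ zero_le_one)
  have hn := numParticles_add_lam_zero τ
  -- Here n is the number of particles plus `lam τ 0`; the m zeros before the first particle give
  -- the factor that cancels x^m.
  have hα' : α ^ n = α ^ (numParticles τ + lam τ 1) * α ^ m := by
    rw [← pow_add]; congr 1; omega
  rw [weight, (vec_eq_detVec (1 / α) (1 / β) τ).2, det_matrixA,
    show lam τ 0 - lam τ 1 = m by omega, hα', one_div, inv_pow]
  field_simp

/-! ### Irreducibility and uniqueness -/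

lemma rate_nonneg {n : ℕ} {α β : ℝ} (hα : 0 < α) (hβ : 0 < β) (σ τ : State n) :
    0 ≤ rate α β σ τ := by
  unfold rate
  split_ifs <;> positivity

lemma rate_pos {n : ℕ} {α β : ℝ} (hα : 0 < α) (hβ : 0 < β) {σ τ : State n}
    (h : Enters σ τ ∨ Exits σ τ ∨ Hops σ τ) : 0 < rate α β σ τ := by
  unfold rate
  rcases h with h | h | h <;> rw [if_pos h] <;> split_ifs <;> positivity

/-- The total of the values of `f` at the particles of `τ`. -/
def potential {n : ℕ} (f : Fin n → ℕ) (τ : State n) : ℕ := ∑ i, if τ i = true then f i else 0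

lemma potential_update_false {n : ℕ} (f : Fin n → ℕ) (τ : State n) {i : Fin n} (h : τ i = true) :
    potential f τ = f i + potential f (Function.update τ i false) := by
  rw [potential, potential, ← Finset.add_sum_erase _ _ (Finset.mem_univ i),
    ← Finset.add_sum_erase Finset.univ (fun j => if Function.update τ i false j = true then f j
      else 0) (Finset.mem_univ i)]
  simp only [h, Function.update_self, if_true, Bool.false_eq_true, if_false, zero_add]
  congr 1
  refine Finset.sum_congr rfl fun j hj => ?_
  rw [Function.update_of_ne (Finset.ne_of_mem_erase hj)]

lemma potential_update_true {n : ℕ} (f : Fin n → ℕ) (τ : State n) {i : Fin n} (h : τ i = false) :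
    potential f (Function.update τ i true) = f i + potential f τ := by
  rw [potential_update_false f _ (Function.update_self i true τ), Function.update_idem,
    Function.update_eq_self_iff.mpr h.symm]

lemma potential_hop {n : ℕ} (f : Fin (n + 1) → ℕ) (τ : State (n + 1)) {i : Fin n}
    (h1 : τ i.castSucc = true) (h0 : τ i.succ = false) :
    potential f (hop i τ) + f i.castSucc = potential f τ + f i.succ := by
  rw [hop, potential_update_true _ _
    (by rw [Function.update_of_ne (castSucc_ne_succ' i).symm, h0]),
    potential_update_false f τ h1]
  ring

/-- A set of states that is closed under predecessors is empty or everything. -/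
lemma forall_of_predecessor_closed {n : ℕ} (S : State (n + 1) → Prop)
    (hS : ∀ σ τ, (Enters σ τ ∨ Exits σ τ ∨ Hops σ τ) → S τ → S σ) {τ₀ : State (n + 1)}
    (hτ₀ : S τ₀) (τ : State (n + 1)) : S τ := by
  -- Undoing an entry or a hop lowers this potential; a state where neither can be undone is empty.
  have hempty : S fun _ => false := by
    induction hN : potential (fun i => (i : ℕ) + 1) τ₀ using Nat.strong_induction_on
      generalizing τ₀ with
    | _ N ih =>
      subst hN
      by_cases h0 : τ₀ 0 = true
      · refine ih _ ?_ (hS (Function.update τ₀ 0 false) τ₀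
          (Or.inl ((enters_iff' _ _).mpr ⟨h0, rfl⟩)) hτ₀) rfl
        rw [potential_update_false _ τ₀ h0]
        simp
      by_cases hb : ∃ i : Fin n, τ₀ i.castSucc = false ∧ τ₀ i.succ = true
      · obtain ⟨i, hi⟩ := hb
        refine ih _ ?_ (hS (unhop i τ₀) τ₀
          (Or.inr (Or.inr ((hops_iff' _ _).mpr ⟨i, hi, rfl⟩))) hτ₀) rfl
        have := potential_hop (fun i => (i : ℕ) + 1) (unhop i τ₀) (unhop_castSucc i τ₀)
          (unhop_succ i τ₀)
        rw [hop_unhop i τ₀ hi.1 hi.2] at this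
        simp at this
        omega
      · push Not at hb
        convert hτ₀ with j
        induction j using Fin.induction with
        | zero => simpa using h0
        | succ i hi => simpa using hb i hi.symm
  -- Conversely, exits and hops lower the reversed potential, so every state leads to the empty one.
  induction hN : potential (fun i => n + 1 - (i : ℕ)) τ using Nat.strong_induction_on
    generalizing τ with
  | _ N ih =>
    subst hN
    by_cases h0 : τ (Fin.last n) = true
    · refine hS τ (Function.update τ (Fin.last n) false)
        (Or.inr (Or.inl ((exits_iff _ _).mpr ⟨h0, rfl⟩))) (ih _ ?_ _ rfl)
      rw [potential_update_false _ τ h0]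
      simp
    by_cases hb : ∃ i : Fin n, τ i.castSucc = true ∧ τ i.succ = false
    · obtain ⟨i, hi⟩ := hb
      refine hS τ (hop i τ) (Or.inr (Or.inr ((hops_iff _ _).mpr ⟨i, hi, rfl⟩))) (ih _ ?_ _ rfl)
      have := potential_hop (fun i => n + 1 - (i : ℕ)) τ hi.1 hi.2
      simp at this
      omega
    · push Not at hb
      convert hempty with j
      induction j using Fin.reverseInduction with
      | last => simpa using h0
      | cast i hi =>
        by_contra h
        exact hb i (by simpa using h) hi

/-- Minimum principle: with c the least ratio π/w, the difference π - cw is nonnegative, balanced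
and zero somewhere. At a zero the inflow vanishes, so all predecessors are zeros too. -/
lemma eq_smul_of_isBalanced {n : ℕ} {α β : ℝ} (hα : 0 < α) (hβ : 0 < β)
    {w π : State (n + 1) → ℝ} (hw : IsBalanced α β w) (hpos : ∀ τ, 0 < w τ)
    (hπ : IsBalanced α β π) : ∃ c : ℝ, ∀ τ, π τ = c * w τ := by
  obtain ⟨τ₀, h₀⟩ := Finite.exists_min fun τ => π τ / w τ
  set c := π τ₀ / w τ₀ with hc
  have hnonneg : ∀ τ, 0 ≤ π τ - c * w τ := fun τ =>
    sub_nonneg.mpr ((le_div_iff₀ (hpos τ)).mp (h₀ τ))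
  refine ⟨c, fun τ => sub_eq_zero.mp ?_⟩
  refine forall_of_predecessor_closed (fun τ => π τ - c * w τ = 0) (fun σ τ hστ hτ => ?_)
    (τ₀ := τ₀) ?_ τ
  · have hsum : ∑ σ, (π σ - c * w σ) * rate α β σ τ = 0 := by
      simp only [sub_mul, Finset.sum_sub_distrib, mul_assoc, ← Finset.mul_sum]
      rw [hπ τ, hw τ, ← mul_assoc, ← sub_mul, hτ, zero_mul]
    have := (Finset.sum_eq_zero_iff_of_nonneg fun σ _ =>
      mul_nonneg (hnonneg σ) (rate_nonneg hα hβ σ τ)).mp hsum σ (Finset.mem_univ σ)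
    exact (mul_eq_zero.mp this).resolve_right (rate_pos hα hβ hστ).ne'
  · rw [hc, div_mul_cancel₀ _ (hpos τ₀).ne', sub_self]

end TASEP

theorem mainTheorem2 (n : ℕ) (hn : 1 ≤ n) (α β : ℝ) (hα : 0 < α) (hβ : 0 < β) :
    (∃! π : TASEP.State n → ℝ, TASEP.IsStationaryDistribution α β π) ∧
      ∀ π : TASEP.State n → ℝ, TASEP.IsStationaryDistribution α β π →
        ∀ τ : TASEP.State n,
          π τ = α ^ (TASEP.numParticles τ + TASEP.lam τ 1) * β ^ n / TASEP.Z n α β *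
            (TASEP.matrixA α β τ).det := by
  have hZ := TASEP.Z_eq_sum_weight hn α β
  have hdet := fun τ : TASEP.State n => TASEP.weight_eq_det hα β τ
  have hpos := fun τ : TASEP.State n =>
    TASEP.weight_pos (one_div_pos.mpr hα) (one_div_pos.mpr hβ) τ
  obtain ⟨n, rfl⟩ := Nat.exists_eq_add_of_le' hn
  have hw : TASEP.IsBalanced α β fun τ : TASEP.State (n + 1) =>
      TASEP.weight (1 / α) (1 / β) τ := TASEP.isBalanced_weight hα hβ
  set W := ∑ τ : TASEP.State (n + 1), TASEP.weight (1 / α) (1 / β) τ with hWdef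
  have hW : 0 < W := Finset.sum_pos (fun τ _ => hpos τ) Finset.univ_nonempty
  have huniq : ∀ π : TASEP.State (n + 1) → ℝ, TASEP.IsStationaryDistribution α β π →
      ∀ τ, π τ = TASEP.weight (1 / α) (1 / β) τ / W := by
    rintro π ⟨hπ, hstat⟩ τ
    obtain ⟨c, hc⟩ := TASEP.eq_smul_of_isBalanced hα hβ hw hpos
      ((TASEP.vecMul_transition_eq_iff α β π).mp hstat)
    have h1 : c * W = 1 := by
      refine Eq.trans ?_ hπ.2
      rw [hWdef, Finset.mul_sum]
      exact Finset.sum_congr rfl fun τ _ => (hc τ).symm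
    rw [hc, eq_div_iff hW.ne']
    linear_combination TASEP.weight (1 / α) (1 / β) τ * h1
  refine ⟨⟨fun τ => TASEP.weight (1 / α) (1 / β) τ / W, ⟨⟨fun τ => (div_pos (hpos τ) hW).le, ?_⟩,
    (TASEP.vecMul_transition_eq_iff α β _).mpr fun τ => ?_⟩, fun π hπ => funext (huniq π hπ)⟩,
    fun π hπ τ => ?_⟩
  · rw [← Finset.sum_div, div_self hW.ne']
  · have := hw τ
    simp only [div_mul_eq_mul_div, ← Finset.sum_div]
    rw [this]
  · rw [huniq π hπ τ, hZ, div_mul_eq_mul_div, mul_right_comm, ← hdet τ, mul_pow]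
    field_simp
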